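/- **Conventions.** For a map $f:A\to B$ between metric spaces let $$\operatorname{Lip}(f)=\sup_{x\ne x'}\frac{d_B(f(x),f(x'))}{d_A(x,x')}\in[0,\infty]\qquad(\sup\varnothing=0).$$ The map $f$ is *Lipschitz* if $\operatorname{Lip}(f)<\infty$, and *$1$-Lipschitz* if $\operatorname{Lip}(f)\le 1$. A metric space $X$ is a *Lipschitz image* of a metric space $Y$ if there is a surjective Lipschitz map $Y\to X$. A metric space $X$ is *injective* if every $1$-Lipschitz map $f:B\to X$ defined on a subspace $B$ of a metric space $A$ extends to a $1$-Lipschitz map $A\to X$. For $x,y$ in a metric space $X$ put $[x,y]=\{z\in X: d_X(x,y)=d_X(x,z)+d_X(z,y)\}$. The space $X$ is an *$\mathbb R$-tree* if for all $x,y\in X$ the set $[x,y]$ is isometric to the real interval $[0,d_X(x,y)]$, and for all $x,y,z\in X$ with $[x,y]\cap[y,z]=\{y\}$ we have $d_X(x,z)=d_X(x,y)+d_X(y,z)$. A metric space $X$ is *Lipschitz connected* if for all $x,y\in X$ there is a Lipschitz map $f:[0,1]\to X$ with $f(0)=x$ and $f(1)=y$. In this case its *intrinsic metric* is $$d_{IX}(x,y)=\inf\{\operatorname{Lip}(f)\;:\;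 f:[0,1]\to X,\ f(0)=x,\ f(1)=y\}.$$ **Theorem.** For a nonempty metric space $X$ the following conditions are equivalent: 1. $X$ is a Lipschitz image of a totally bounded injective metric space; 2. $X$ is a Lipschitz image of a compact $\mathbb R$-tree; 3. $X$ is compact and Lipschitz connected, and the metric space $(X,d_{IX})$ is totally bounded. -/

import Mathlib

open scoped NNReal ENNReal

universe u v

namespace LipschitzImages

/-- The Lipschitz constant `Lip(f) ∈ [0, ∞]` of a map between metric spaces
(the supremum of the empty set being `0`). -/
noncomputable def lipConst {A : Type u} {B : Type v} [MetricSpace A] [MetricSpace B]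
    (f : A → B) : ℝ≥0∞ :=
  ⨆ (x : A) (x' : A) (_ : x ≠ x'), edist (f x) (f x') / edist x x'

/-- A map is Lipschitz if its Lipschitz constant is finite. -/
def IsLipschitz {A : Type u} {B : Type v} [MetricSpace A] [MetricSpace B] (f : A → B) : Prop :=
  lipConst f < ∞

/-- `X` is a Lipschitz image of `Y`: there is a surjective Lipschitz map `Y → X`. -/
def IsLipschitzImage (X : Type u) (Y : Type v) [MetricSpace X] [MetricSpace Y] : Prop :=
  ∃ f : Y → X, Function.Surjective f ∧ IsLipschitz f

/-- A metric space `X` is injective if every `1`-Lipschitz map `f : B → X` from a subspace `B` of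
a metric space `A` extends to a `1`-Lipschitz map `A → X`. -/
def IsInjectiveSpace (X : Type u) [MetricSpace X] : Prop :=
  ∀ (A : Type u) [MetricSpace A] (B : Set A) (f : B → X), lipConst f ≤ 1 →
    ∃ g : A → X, lipConst g ≤ 1 ∧ ∀ b : B, g b = f b

/-- The metric segment `[x, y]`. -/
def metricSegment {X : Type u} [MetricSpace X] (x y : X) : Set X :=
  {z | dist x y = dist x z + dist z y}

/-- A metric space is an `ℝ`-tree if every metric segment `[x, y]` is isometric to the real
interval `[0, d(x, y)]`, and `[x, y] ∩ [y, z] = {y}` implies `d(x, z) = d(x, y) + d(y, z)`. -/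
def IsRTree (X : Type u) [MetricSpace X] : Prop :=
  (∀ x y : X, Nonempty (metricSegment x y ≃ᵢ Set.Icc (0 : ℝ) (dist x y))) ∧
  ∀ x y z : X, metricSegment x y ∩ metricSegment y z = {y} →
    dist x z = dist x y + dist y z

/-- The metric of `X` is totally bounded. -/
def IsTotallyBounded (X : Type u) [MetricSpace X] : Prop :=
  TotallyBounded (Set.univ : Set X)

/-- Any two points are joined by a Lipschitz path `[0, 1] → X`. -/
def IsLipschitzConnected (X : Type u) [MetricSpace X] : Prop :=
  ∀ x y : X, ∃ f : unitInterval → X, IsLipschitz f ∧ f 0 = x ∧ f 1 = y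

/-- The infimum of `Lip(f)` over all functions `f : [0, 1] → X` with `f 0 = x` and `f 1 = y`,
as an element of `[0, ∞]`. -/
noncomputable def intrinsicEDist {X : Type u} [MetricSpace X] (x y : X) : ℝ≥0∞ :=
  ⨅ (f : unitInterval → X) (_ : f 0 = x) (_ : f 1 = y), lipConst f

theorem lipConst_le_iff {A : Type u} {B : Type v} [MetricSpace A] [MetricSpace B]
    (f : A → B) (K : ℝ≥0) : lipConst f ≤ K ↔ LipschitzWith K f := by
  simp only [lipConst, iSup_le_iff, LipschitzWith]
  refine forall_congr' fun x => forall_congr' fun y => ?_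
  by_cases h : x = y
  · simp [h]
  · rw [ENNReal.div_le_iff (by simpa using h) (edist_ne_top _ _)]
    simp [h]

theorem isLipschitz_iff {A : Type u} {B : Type v} [MetricSpace A] [MetricSpace B]
    (f : A → B) : IsLipschitz f ↔ ∃ K : ℝ≥0, LipschitzWith K f := by
  constructor
  · intro h
    exact ⟨(lipConst f).toNNReal, (lipConst_le_iff f _).1 (ENNReal.coe_toNNReal h.ne).ge⟩
  · rintro ⟨K, hK⟩
    exact lt_of_le_of_lt ((lipConst_le_iff f K).2 hK) ENNReal.coe_lt_top

section IntrinsicMetric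

variable {X : Type u} [MetricSpace X]

theorem intrinsicEDist_le {x y : X} {K : ℝ≥0} (f : unitInterval → X) (h0 : f 0 = x) (h1 : f 1 = y)
    (hf : LipschitzWith K f) : intrinsicEDist x y ≤ K :=
  (iInf₂_le_of_le f h0 (iInf_le _ h1)).trans ((lipConst_le_iff f K).2 hf)

theorem exists_path_of_intrinsicEDist_lt {x y : X} {K : ℝ≥0} (h : intrinsicEDist x y < K) :
    ∃ f : unitInterval → X, f 0 = x ∧ f 1 = y ∧ LipschitzWith K f := by
  simp only [intrinsicEDist, iInf_lt_iff] at h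
  obtain ⟨f, h0, h1, hf⟩ := h
  exact ⟨f, h0, h1, (lipConst_le_iff f K).1 hf.le⟩

theorem edist_le_intrinsicEDist (x y : X) : edist x y ≤ intrinsicEDist x y := by
  refine ENNReal.le_of_forall_pos_le_add fun ε hε hfin => ?_
  have hlt : intrinsicEDist x y < (((intrinsicEDist x y).toNNReal + ε : ℝ≥0) : ℝ≥0∞) := by
    rw [ENNReal.coe_add, ENNReal.coe_toNNReal hfin.ne]
    exact ENNReal.lt_add_right hfin.ne (by simpa using hε.ne')
  obtain ⟨f, h0, h1, hf⟩ := exists_path_of_intrinsicEDist_lt hlt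
  have := hf 0 1
  have h01 : edist (0 : unitInterval) 1 = 1 := by
    rw [edist_dist, Subtype.dist_eq, Real.dist_eq]
    simp
  rw [h0, h1, h01, mul_one, ENNReal.coe_add, ENNReal.coe_toNNReal hfin.ne] at this
  exact this

theorem intrinsicEDist_self (x : X) : intrinsicEDist x x = 0 := by
  simpa using intrinsicEDist_le (K := 0) (fun _ => x) rfl rfl (LipschitzWith.const x)

theorem intrinsicEDist_comm_le (x y : X) : intrinsicEDist x y ≤ intrinsicEDist y x := by
  refine ENNReal.le_of_forall_pos_le_add fun ε hε hfin => ?_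
  have hlt : intrinsicEDist y x < (((intrinsicEDist y x).toNNReal + ε : ℝ≥0) : ℝ≥0∞) := by
    rw [ENNReal.coe_add, ENNReal.coe_toNNReal hfin.ne]
    exact ENNReal.lt_add_right hfin.ne (by simpa using hε.ne')
  obtain ⟨f, h0, h1, hf⟩ := exists_path_of_intrinsicEDist_lt hlt
  have hs : LipschitzWith 1 unitInterval.symm := by
    refine LipschitzWith.of_dist_le_mul fun a b => ?_
    rw [Subtype.dist_eq, Subtype.dist_eq, Real.dist_eq, Real.dist_eq, unitInterval.coe_symm_eq,
      unitInterval.coe_symm_eq, sub_sub_sub_cancel_left, abs_sub_comm]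
    simp
  have := intrinsicEDist_le (fun t => f (unitInterval.symm t)) (x := x) (y := y) (by simpa using h1)
    (by simpa using h0) (hf.comp hs)
  rwa [mul_one, ENNReal.coe_add, ENNReal.coe_toNNReal hfin.ne] at this

/-- Concatenation of Lipschitz paths. -/
theorem exists_path_concat {x y z : X} {a b : ℝ≥0} (ha : 0 < a) (hb : 0 < b)
    {f g : unitInterval → X} (f0 : f 0 = x) (f1 : f 1 = y) (hf : LipschitzWith a f)
    (g0 : g 0 = y) (g1 : g 1 = z) (hg : LipschitzWith b g) :
    ∃ h : unitInterval → X, h 0 = x ∧ h 1 = z ∧ LipschitzWith (a + b) h := by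
  have ha' : (0 : ℝ) < a := ha
  have hb' : (0 : ℝ) < b := hb
  set F : ℝ → X := fun s => f (Set.projIcc 0 1 zero_le_one (s / a)) with hF
  set G : ℝ → X := fun s => g (Set.projIcc 0 1 zero_le_one ((s - a) / b)) with hG
  have F0 : F 0 = x := by simp [hF, f0]
  have Fa : F a = y := by simp [hF, div_self ha'.ne', f1]
  have Ga : G a = y := by simp [hG, g0]
  have Gab : G (a + b) = z := by simp [hG, div_self hb'.ne', g1]
  have hproj : ∀ s t : ℝ, dist (Set.projIcc (0 : ℝ) 1 zero_le_one s)
      (Set.projIcc (0 : ℝ) 1 zero_le_one t) ≤ dist s t := fun s t => by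
    simpa using (LipschitzWith.projIcc (zero_le_one (α := ℝ))).dist_le_mul s t
  have hFd : ∀ s t, dist (F s) (F t) ≤ |s - t| := by
    intro s t
    refine (hf.dist_le_mul _ _).trans ?_
    calc (a : ℝ) * _ ≤ a * dist (s / a) (t / a) := by gcongr; exact hproj _ _
      _ = |s - t| := by
        rw [Real.dist_eq, ← sub_div, abs_div, abs_of_pos ha']; field_simp
  have hGd : ∀ s t, dist (G s) (G t) ≤ |s - t| := by
    intro s t
    refine (hg.dist_le_mul _ _).trans ?_
    calc (b : ℝ) * _ ≤ b * dist ((s - a) / b) ((t - a) / b) := by gcongr; exact hproj _ _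
      _ = |s - t| := by
        rw [Real.dist_eq, ← sub_div, abs_div, abs_of_pos hb']; field_simp; congr 1; ring
  set H : ℝ → X := fun s => if s ≤ a then F s else G s with hH
  have key : ∀ s t : ℝ, s ≤ a → ¬ t ≤ a → dist (F s) (G t) ≤ |s - t| := by
    intro s t hs ht
    have h1 := hFd s a
    have h2 := hGd a t
    rw [Fa] at h1
    rw [Ga] at h2
    have := dist_triangle (F s) y (G t)
    rw [abs_of_nonpos (by linarith)] at h1 h2 ⊢
    linarith
  have hHd : ∀ s t, dist (H s) (H t) ≤ |s - t| := by
    intro s t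
    by_cases hs : s ≤ a <;> by_cases ht : t ≤ a
    · simpa [hH, hs, ht] using hFd s t
    · simpa [hH, hs, ht] using key s t hs ht
    · rw [dist_comm, abs_sub_comm]
      simpa [hH, hs, ht] using key t s ht hs
    · simpa [hH, hs, ht] using hGd s t
  refine ⟨fun t => H ((a + b) * t), ?_, ?_, ?_⟩
  · simp [hH, F0]
  · have : ¬ ((a : ℝ) + b ≤ a) := by linarith
    simp only [hH, Set.Icc.coe_one, mul_one, if_neg this, Gab]
  · refine LipschitzWith.of_dist_le_mul fun s t => (hHd _ _).trans ?_
    rw [← mul_sub, abs_mul, abs_of_pos (by linarith), Subtype.dist_eq, Real.dist_eq]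
    push_cast
    exact le_rfl

theorem intrinsicEDist_triangle (x y z : X) :
    intrinsicEDist x z ≤ intrinsicEDist x y + intrinsicEDist y z := by
  refine ENNReal.le_of_forall_pos_le_add fun ε hε hfin => ?_
  have h1 : intrinsicEDist x y ≠ ∞ := fun h => by simp [h] at hfin
  have h2 : intrinsicEDist y z ≠ ∞ := fun h => by simp [h] at hfin
  have hlt : ∀ c : ℝ≥0∞, c ≠ ∞ → c < ((c.toNNReal + ε / 2 : ℝ≥0) : ℝ≥0∞) := by
    intro c hc
    rw [ENNReal.coe_add, ENNReal.coe_toNNReal hc]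
    exact ENNReal.lt_add_right hc (by simpa using hε.ne')
  obtain ⟨f, f0, f1, hf⟩ := exists_path_of_intrinsicEDist_lt (hlt _ h1)
  obtain ⟨g, g0, g1, hg⟩ := exists_path_of_intrinsicEDist_lt (hlt _ h2)
  obtain ⟨h, h0, h1', hh⟩ := exists_path_concat (by positivity) (by positivity) f0 f1 hf g0 g1 hg
  refine (intrinsicEDist_le h h0 h1' hh).trans (le_of_eq ?_)
  rw [add_add_add_comm, add_halves, ENNReal.coe_add, ENNReal.coe_add, ENNReal.coe_toNNReal h1,
    ENNReal.coe_toNNReal h2]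

theorem intrinsicEDist_ne_top (h : IsLipschitzConnected X) (x y : X) :
    intrinsicEDist x y ≠ ∞ := by
  obtain ⟨f, hf, h0, h1⟩ := h x y
  obtain ⟨K, hK⟩ := (isLipschitz_iff f).1 hf
  exact ((intrinsicEDist_le f h0 h1 hK).trans_lt ENNReal.coe_lt_top).ne

end IntrinsicMetric

/-- The intrinsic metric `d_I(x, y) = inf {Lip(f) : f : [0, 1] → X, f 0 = x, f 1 = y}` of a
Lipschitz connected metric space. It is a second metric on the set `X`. -/
@[reducible] noncomputable def intrinsicMetricSpace {X : Type u} [MetricSpace X]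
    (h : IsLipschitzConnected X) : MetricSpace X where
  dist x y := (intrinsicEDist x y).toReal
  dist_self x := by simp [intrinsicEDist_self]
  dist_comm x y := by
    rw [(intrinsicEDist_comm_le x y).antisymm (intrinsicEDist_comm_le y x)]
  dist_triangle x y z := by
    rw [← ENNReal.toReal_add (intrinsicEDist_ne_top h x y) (intrinsicEDist_ne_top h y z)]
    exact ENNReal.toReal_mono
      (ENNReal.add_ne_top.2 ⟨intrinsicEDist_ne_top h x y, intrinsicEDist_ne_top h y z⟩)
      (intrinsicEDist_triangle x y z)
  eq_of_dist_eq_zero {x y} hxy := by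
    have h0 : intrinsicEDist x y = 0 :=
      (ENNReal.toReal_eq_zero_iff _).1 hxy |>.resolve_right (intrinsicEDist_ne_top h x y)
    exact edist_eq_zero.1 (le_antisymm (h0 ▸ edist_le_intrinsicEDist x y) zero_le)

end LipschitzImages

namespace LipschitzImages

/-! Conditions 1 and 2 both supply a compact geodesic space: injective spaces are geodesic and
complete, and segments of an `ℝ`-tree are geodesics. A `K`-Lipschitz map from a geodesic space onto
`X` stays `K`-Lipschitz for the intrinsic metric of `X`, which gives condition 3
(`compactSpace_and_intrinsic_totallyBounded`).

Conversely, one tree serves both conditions. Take finite nets `A n` of mesh `C * 2⁻ⁿ` for the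
intrinsic metric. The sequences in `∏ A n` form a compact ultrametric space, the ends of a rooted
tree of height 1 (`EndTree`) that is a compact `ℝ`-tree (`EndTree.isRTree`) and injective
(`EndTree.isInjectiveSpace`). Each end `σ` gives a ray in `X` that leaves a base point at depth 1
and, when consecutive points are close, reaches `σ 0`, `σ 1`, ... at depths 1/2, 1/4, ... with
bounded speed (`exists_rays`). Ends with the same first `n` entries share their rays at depths at
least `2⁻ⁿ`, so the rays glue to a Lipschitz map on the tree. It is onto because every point is the
limit of its approximations in the nets. -/

theorem lipConst_le_one_iff {A : Type u} {B : Type v} [MetricSpace A] [MetricSpace B]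
    (f : A → B) : lipConst f ≤ 1 ↔ LipschitzWith 1 f := by
  rw [← lipConst_le_iff, ENNReal.coe_one]

theorem isTotallyBounded_intrinsicMetricSpace_iff {X : Type u} [MetricSpace X]
    (h : IsLipschitzConnected X) :
    @IsTotallyBounded X (intrinsicMetricSpace h) ↔
      ∀ ε > 0, ∃ t : Set X, t.Finite ∧ ∀ x, ∃ y ∈ t, (intrinsicEDist x y).toReal < ε := by
  unfold IsTotallyBounded
  rw [@Metric.totallyBounded_iff X (intrinsicMetricSpace h).toPseudoMetricSpace]
  refine forall₂_congr fun ε _ => exists_congr fun t => and_congr_right fun _ => ?_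
  simp only [Set.subset_def, Set.mem_univ, true_implies, Set.mem_iUnion, exists_prop]
  rfl

/-! ### Geodesic spaces and the necessity of condition 3 -/

/-- Any two points are joined by a constant speed geodesic. -/
def IsGeodesic (Y : Type u) [MetricSpace Y] : Prop :=
  ∀ x y : Y, ∃ g : unitInterval → Y, g 0 = x ∧ g 1 = y ∧ LipschitzWith (nndist x y) g

/-- Geodesics of `Y` push forward to paths in `X`, so the surjection is Lipschitz into the intrinsic
metric and carries finite nets to finite nets. -/
theorem compactSpace_and_intrinsic_totallyBounded {X : Type u} {Y : Type v} [MetricSpace X]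
    [MetricSpace Y] [CompactSpace Y] (hY : IsGeodesic Y) (hXY : IsLipschitzImage X Y) :
    CompactSpace X ∧ ∃ h : IsLipschitzConnected X,
      @IsTotallyBounded X (intrinsicMetricSpace h) := by
  obtain ⟨f, hsurj, hf⟩ := hXY
  obtain ⟨K, hK⟩ := (isLipschitz_iff f).1 hf
  have hle : ∀ x y, intrinsicEDist (f x) (f y) ≤ (K * nndist x y : ℝ≥0) := by
    intro x y
    obtain ⟨g, g0, g1, hg⟩ := hY x y
    exact intrinsicEDist_le (f ∘ g) (by simp [g0]) (by simp [g1]) (hK.comp hg)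
  have hconn : IsLipschitzConnected X := by
    intro x y
    obtain ⟨x, rfl⟩ := hsurj x
    obtain ⟨y, rfl⟩ := hsurj y
    obtain ⟨g, g0, g1, hg⟩ := hY x y
    exact ⟨f ∘ g, (isLipschitz_iff _).2 ⟨_, hK.comp hg⟩, by simp [g0], by simp [g1]⟩
  refine ⟨hsurj.compactSpace hK.continuous, hconn, ?_⟩
  rw [isTotallyBounded_intrinsicMetricSpace_iff]
  intro ε hε
  have htb : TotallyBounded (Set.univ : Set Y) := isCompact_univ.totallyBounded
  -- `K` may be zero, hence the radius `ε / (K + 1)`.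
  have hK1 : (0 : ℝ) < K + 1 := by positivity
  obtain ⟨t, ht, hcov⟩ := Metric.totallyBounded_iff.1 htb (ε / (K + 1)) (by positivity)
  refine ⟨f '' t, ht.image f, fun x => ?_⟩
  obtain ⟨x, rfl⟩ := hsurj x
  obtain ⟨y, hy, hxy⟩ := Set.mem_iUnion₂.1 (hcov (Set.mem_univ x))
  refine ⟨f y, Set.mem_image_of_mem f hy, ?_⟩
  have h1 : (intrinsicEDist (f x) (f y)).toReal ≤ K * dist x y := by
    have := ENNReal.toReal_mono ENNReal.coe_ne_top (hle x y)
    simpa [edist_dist] using this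
  rw [Metric.mem_ball, lt_div_iff₀ hK1] at hxy
  nlinarith [dist_nonneg (x := x) (y := y)]

theorem IsRTree.isGeodesic {Y : Type u} [MetricSpace Y] (hY : IsRTree Y) : IsGeodesic Y := by
  intro x y
  obtain ⟨e⟩ := hY.1 x y
  -- The isometry need not send `x` to `0`, so the geodesic interpolates between the images `a` and
  -- `b`, which are at distance `dist x y`.
  set a := e ⟨x, by simp [metricSegment]⟩ with ha
  set b := e ⟨y, by simp [metricSegment]⟩ with hb
  have hab : dist a b = dist x y := by rw [ha, hb, e.isometry.dist_eq]; rfl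
  have hmem : ∀ t : unitInterval, (1 - (t : ℝ)) * a + t * b ∈ Set.Icc (0 : ℝ) (dist x y) :=
    fun t => (convex_Icc (0 : ℝ) (dist x y)) a.2 b.2 (by linarith [t.2.2]) t.2.1 (by ring)
  refine ⟨fun t => (e.symm ⟨_, hmem t⟩ : metricSegment x y), ?_, ?_, ?_⟩
  · have : (⟨_, hmem 0⟩ : Set.Icc (0 : ℝ) (dist x y)) = a := by ext; simp
    exact congrArg Subtype.val ((congrArg e.symm this).trans (e.symm_apply_apply _))
  · have : (⟨_, hmem 1⟩ : Set.Icc (0 : ℝ) (dist x y)) = b := by ext; simp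
    exact congrArg Subtype.val ((congrArg e.symm this).trans (e.symm_apply_apply _))
  · refine LipschitzWith.of_dist_le_mul fun s t => ?_
    have hst : dist (⟨_, hmem s⟩ : Set.Icc (0 : ℝ) (dist x y)) ⟨_, hmem t⟩ =
        dist a b * dist s t := by
      simp only [Subtype.dist_eq, Real.dist_eq]
      rw [abs_sub_comm (a : ℝ) b, ← abs_mul]
      congr 1
      ring
    rw [← Subtype.dist_eq, e.symm.isometry.dist_eq, hst, hab, coe_nndist]

/-- Extend the map on the two points `0` and `dist x y` to the whole real line, lifted to the
universe of `Y`. -/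
theorem IsInjectiveSpace.isGeodesic {Y : Type u} [MetricSpace Y] (hY : IsInjectiveSpace Y) :
    IsGeodesic Y := by
  classical
  intro x y
  obtain ⟨g, hg, hgf⟩ := hY (ULift.{u} ℝ) {⟨0⟩, ⟨dist x y⟩}
    (fun b => if (b : ULift.{u} ℝ).down = 0 then x else y) (by
      rw [lipConst_le_one_iff]
      refine LipschitzWith.of_dist_le_mul ?_
      rintro ⟨s, rfl | rfl⟩ ⟨t, rfl | rfl⟩ <;> by_cases hxy : x = y <;>
        simp [hxy, Subtype.dist_eq, ULift.dist_eq, dist_comm])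
  rw [lipConst_le_one_iff] at hg
  refine ⟨fun t => g ⟨dist x y * t⟩, ?_, ?_, ?_⟩
  · simpa using hgf ⟨⟨0⟩, by simp⟩
  · have := hgf ⟨⟨dist x y⟩, by simp⟩
    by_cases hxy : x = y
    · subst hxy
      simpa using this
    · simpa [hxy] using this
  · refine LipschitzWith.of_dist_le_mul fun s t => (hg.dist_le_mul _ _).trans (le_of_eq ?_)
    rw [ULift.dist_eq, Real.dist_eq, Subtype.dist_eq, Real.dist_eq, ← mul_sub, abs_mul]
    simp

/-- Injectivity gives a 1-Lipschitz retraction of the completion onto `Y`. It is the identity on a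
dense set, hence everywhere, so `Y` is its own completion. -/
theorem IsInjectiveSpace.completeSpace {Y : Type u} [MetricSpace Y] (hY : IsInjectiveSpace Y) :
    CompleteSpace Y := by
  have hiso : Isometry ((↑) : Y → UniformSpace.Completion Y) :=
    UniformSpace.Completion.coe_isometry
  obtain ⟨g, hg, hgf⟩ := hY (UniformSpace.Completion Y) (Set.range (↑))
    (fun b => b.2.choose) (by
      rw [lipConst_le_one_iff]
      refine LipschitzWith.of_dist_le_mul fun a b => ?_
      rw [← hiso.dist_eq, a.2.choose_spec, b.2.choose_spec]
      simp [Subtype.dist_eq])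
  rw [lipConst_le_one_iff] at hg
  have hgc : ∀ y : Y, g y = y := fun y =>
    (hgf ⟨y, y, rfl⟩).trans (hiso.injective (⟨y, rfl⟩ : (y : UniformSpace.Completion Y) ∈ Set.range
      ((↑) : Y → UniformSpace.Completion Y)).choose_spec)
  have hid : (fun z => ((g z : Y) : UniformSpace.Completion Y)) = id :=
    UniformSpace.Completion.ext (hiso.continuous.comp hg.continuous) continuous_id
      fun y => by simp [hgc]
  rw [hiso.isUniformInducing.completeSpace_congr fun z => ⟨g z, congrFun hid z⟩]
  infer_instance

/-! ### The four point criterion for `ℝ`-trees -/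

/-- A geodesic metric space satisfying the four point condition is an `ℝ`-tree. -/
theorem isRTree_of_fourPoint {T : Type u} [MetricSpace T]
    (h4 : ∀ x y z w : T,
      dist x y + dist z w ≤ max (dist x z + dist y w) (dist x w + dist y z))
    (hgeo : ∀ x y : T, ∃ γ : ℝ → T, γ 0 = x ∧ γ (dist x y) = y ∧
      ∀ s ∈ Set.Icc 0 (dist x y), ∀ t ∈ Set.Icc 0 (dist x y), dist (γ s) (γ t) = |s - t|) :
    IsRTree T := by
  have hl : ∀ {x y : T} {γ : ℝ → T}, γ 0 = x → (∀ s ∈ Set.Icc 0 (dist x y),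
      ∀ t ∈ Set.Icc 0 (dist x y), dist (γ s) (γ t) = |s - t|) →
      ∀ s ∈ Set.Icc 0 (dist x y), dist x (γ s) = s := by
    intro x y γ h0 hγ s hs
    have := hγ 0 ⟨le_rfl, dist_nonneg⟩ s hs
    rwa [h0, zero_sub, abs_neg, abs_of_nonneg hs.1] at this
  have hr : ∀ {x y : T} {γ : ℝ → T}, γ (dist x y) = y → (∀ s ∈ Set.Icc 0 (dist x y),
      ∀ t ∈ Set.Icc 0 (dist x y), dist (γ s) (γ t) = |s - t|) →
      ∀ s ∈ Set.Icc 0 (dist x y), dist (γ s) y = dist x y - s := by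
    intro x y γ h1 hγ s hs
    have := hγ s hs (dist x y) ⟨dist_nonneg, le_rfl⟩
    rwa [h1, abs_sub_comm, abs_of_nonneg (by linarith [hs.2])] at this
  constructor
  · intro x y
    obtain ⟨γ, h0, h1, hγ⟩ := hgeo x y
    have hmem : ∀ s : Set.Icc 0 (dist x y), γ s ∈ metricSegment x y := fun s => by
      simp [metricSegment, hl h0 hγ s s.2, hr h1 hγ s s.2]
    refine ⟨(IsometryEquiv.mk (Equiv.ofBijective (fun s => ⟨γ s, hmem s⟩) ⟨?_, ?_⟩) ?_).symm⟩
    · intro s t hst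
      have := hγ s s.2 t t.2
      rw [show γ s = γ t from congrArg Subtype.val hst, dist_self] at this
      exact Subtype.ext (sub_eq_zero.1 (abs_eq_zero.1 this.symm))
    · rintro ⟨z, hz⟩
      have hz' : dist x y = dist x z + dist z y := hz
      have hs : dist x z ∈ Set.Icc 0 (dist x y) :=
        ⟨dist_nonneg, by linarith [dist_nonneg (x := z) (y := y)]⟩
      refine ⟨⟨dist x z, hs⟩, Subtype.ext (dist_le_zero.1 ?_)⟩
      -- Both terms of the maximum equal `dist x y`, so `z` is the point of the geodesic at distance
      -- `dist x z` from `x`.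
      have h := h4 (γ (dist x z)) z x y
      rw [dist_comm _ x, hl h0 hγ _ hs, hr h1 hγ _ hs, dist_comm z x, max_eq_left] at h
      · simp only
        linarith
      · linarith
    · exact Isometry.of_dist_eq fun s t => hγ s s.2 t t.2
  · intro x y z hxyz
    obtain ⟨γ, h0, h1, hγ⟩ := hgeo y x
    obtain ⟨δ, k0, k1, hδ⟩ := hgeo y z
    have t1 := dist_triangle x y z
    have t2 := dist_triangle x z y
    have t3 := dist_triangle y x z
    rw [dist_comm z y] at t2
    have hc := dist_comm x y
    -- The Gromov product of `x` and `z` at `y`. The point `γ g` at this distance from `y` towards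
    -- `x` also lies in `[y, z]`, so it is `y` and `g = 0`.
    set g := (dist x y + dist y z - dist x z) / 2 with hg
    have g1 : g ∈ Set.Icc 0 (dist y x) := ⟨by linarith, by linarith⟩
    have g2 : g ∈ Set.Icc 0 (dist y z) := ⟨by linarith, by linarith⟩
    have hp : dist y (γ g) = g := hl h0 hγ g g1
    have hpx := hr h1 hγ g g1
    have hq : dist y (δ g) = g := hl k0 hδ g g2
    have hqz := hr k1 hδ g g2
    have hpz : dist (γ g) z ≤ dist y z - g := by
      have h := h4 (γ g) z x y
      have hzx := dist_comm z x
      have hpy := dist_comm (γ g) y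
      have hzy := dist_comm z y
      rcases le_max_iff.1 h with h | h <;> linarith
    have hpq : dist (γ g) (δ g) ≤ 0 := by
      have h := h4 (γ g) (δ g) y z
      have hpy := dist_comm (γ g) y
      have hqy := dist_comm (δ g) y
      rcases le_max_iff.1 h with h | h <;> linarith
    have hmem : γ g ∈ metricSegment x y ∩ metricSegment y z := by
      refine ⟨?_, ?_⟩
      · change dist x y = dist x (γ g) + dist (γ g) y
        rw [dist_comm x (γ g), dist_comm (γ g) y]
        linarith
      · change dist y z = dist y (γ g) + dist (γ g) z
        have := dist_triangle y (γ g) z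
        linarith
    rw [hxyz, Set.mem_singleton_iff] at hmem
    rw [hmem, dist_self] at hp
    linarith

/-! ### The tree over an ultrametric space of ends -/

/-- Points of the tree whose space of ends is the ultrametric space `E`: the point `(σ, a)` lies at
depth `a` below the end `σ`, and `(σ, a)`, `(τ, a)` are identified once `dist σ τ ≤ a`. -/
@[ext] structure EndTree (E : Type u) where
  /-- An end above the point. -/
  tip : E
  /-- The depth of the point below its end. -/
  depth : unitInterval

namespace EndTree

variable {E : Type u}

section Branch

variable [PseudoMetricSpace E]

/-- The depth of the branch point of two points. -/
noncomputable def branch (p q : EndTree E) : ℝ :=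
  max (max (p.depth : ℝ) q.depth) (dist p.tip q.tip)

theorem branch_comm (p q : EndTree E) : branch p q = branch q p := by
  rw [branch, branch, dist_comm, max_comm (p.depth : ℝ)]

theorem branch_self (p : EndTree E) : branch p p = p.depth := by
  simp [branch, p.depth.2.1]

theorem le_branch_left (p q : EndTree E) : (p.depth : ℝ) ≤ branch p q := by simp [branch]

theorem le_branch_right (p q : EndTree E) : (q.depth : ℝ) ≤ branch p q := by simp [branch]

theorem branch_le_one (h : ∀ σ τ : E, dist σ τ ≤ 1) (p q : EndTree E) : branch p q ≤ 1 := by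
  simp [branch, h, p.depth.2.2, q.depth.2.2]

end Branch

variable [PseudoMetricSpace E] [IsUltrametricDist E]

theorem branch_le_max (p q r : EndTree E) : branch p r ≤ max (branch p q) (branch q r) := by
  have h := dist_triangle_max p.tip q.tip r.tip
  simp only [branch, le_max_iff, max_le_iff] at h ⊢
  grind

/-- The length of the route from `p` down to the branch point and up again to `q`. It vanishes
exactly on the identified points. -/
noncomputable instance : PseudoMetricSpace (EndTree E) where
  dist p q := 2 * branch p q - p.depth - q.depth
  dist_self p := by rw [branch_self]; ring
  dist_comm p q := by rw [branch_comm]; ring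
  dist_triangle p q r := by
    have h1 := le_branch_right p q
    have h2 := le_branch_left q r
    rcases le_max_iff.1 (branch_le_max p q r) with h | h <;> linarith

theorem dist_eq (p q : EndTree E) : dist p q = 2 * branch p q - p.depth - q.depth := rfl

theorem dist_mk_same (σ : E) (a b : unitInterval) : dist (mk σ a) (mk σ b) = |(a : ℝ) - b| := by
  rw [dist_eq]
  rcases le_total (a : ℝ) b with h | h
  · simp [branch, h, b.2.1, abs_of_nonpos (sub_nonpos.2 h)]
    ring
  · simp [branch, h, a.2.1, abs_of_nonneg (sub_nonneg.2 h)]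
    ring

/-- All three sums contain the same four depths, so only the branch depths matter, and these satisfy
the ultrametric inequality `branch_le_max`. -/
theorem four_point (p q r s : EndTree E) :
    dist p q + dist r s ≤ max (dist p r + dist q s) (dist p s + dist q r) := by
  have key : branch p q + branch r s ≤
      max (branch p r + branch q s) (branch p s + branch q r) := by
    have h1 := branch_le_max p r q
    have h2 := branch_le_max p s q
    have h3 := branch_le_max r p s
    have h4 := branch_le_max r q s
    rw [branch_comm r q] at h1
    rw [branch_comm s q] at h2
    rw [branch_comm r p] at h3
    rw [branch_comm r q] at h4
    simp only [le_max_iff] at h1 h2 h3 h4 ⊢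
    grind
  simp only [dist_eq]
  rcases le_max_iff.1 key with h | h
  · exact le_max_of_le_left (by linarith)
  · exact le_max_of_le_right (by linarith)

theorem dist_le_of_branch_le {p q : EndTree E} {c : ℝ} (h : branch p q ≤ c) :
    dist p q ≤ 2 * c - p.depth - q.depth := by
  rw [dist_eq]
  linarith

/-- Follow the ray of `p` to the branch depth `M`, then the ray of `q` back. The bound on `E` keeps
`M` at most 1, the depth of the root. -/
theorem exists_geodesic (h : ∀ σ τ : E, dist σ τ ≤ 1) (p q : EndTree E) :
    ∃ γ : ℝ → EndTree E, dist (γ 0) p = 0 ∧ dist (γ (dist p q)) q = 0 ∧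
      ∀ s ∈ Set.Icc 0 (dist p q), ∀ t ∈ Set.Icc 0 (dist p q), dist (γ s) (γ t) = |s - t| := by
  have hM := branch_le_one h p q
  have hp := le_branch_left p q
  have hq := le_branch_right p q
  have hp0 := p.depth.2.1
  have hq0 := q.depth.2.1
  have hd := dist_eq p q
  have hpq : dist p.tip q.tip ≤ branch p q := le_max_right _ _
  set M := branch p q with hMdef
  set d := dist p q with hddef
  set P : ℝ → EndTree E := fun v => ⟨p.tip, Set.projIcc 0 1 zero_le_one v⟩ with hP
  set Q : ℝ → EndTree E := fun v => ⟨q.tip, Set.projIcc 0 1 zero_le_one v⟩ with hQ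
  have hproj : ∀ v : ℝ, 0 ≤ v → v ≤ 1 →
      ((Set.projIcc (0 : ℝ) 1 zero_le_one v : Set.Icc (0 : ℝ) 1) : ℝ) = v :=
    fun v h0 h1 => by rw [Set.projIcc_of_mem zero_le_one ⟨h0, h1⟩]
  have hPP : ∀ v w, 0 ≤ v → v ≤ 1 → 0 ≤ w → w ≤ 1 → dist (P v) (P w) = |v - w| := by
    intro v w h1 h2 h3 h4
    rw [hP, dist_mk_same, hproj v h1 h2, hproj w h3 h4]
  have hQQ : ∀ v w, 0 ≤ v → v ≤ 1 → 0 ≤ w → w ≤ 1 → dist (Q v) (Q w) = |v - w| := by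
    intro v w h1 h2 h3 h4
    rw [hQ, dist_mk_same, hproj v h1 h2, hproj w h3 h4]
  have hPQM : dist (P M) (Q M) ≤ 0 := by
    have hb : branch (P M) (Q M) ≤ M := by
      simp only [branch, hP, hQ, hproj M (hp0.trans hp) hM, max_self, max_le_iff, le_refl,
        true_and]
      exact hpq
    refine (dist_le_of_branch_le hb).trans (le_of_eq ?_)
    simp only [hP, hQ, hproj M (hp0.trans hp) hM]
    ring
  have hPQ : ∀ v w, 0 ≤ v → v ≤ M → 0 ≤ w → w ≤ M → p.depth ≤ v → q.depth ≤ w →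
      dist (P v) (Q w) = 2 * M - v - w := by
    intro v w h1 h2 h3 h4 h5 h6
    refine le_antisymm ?_ ?_
    · have e1 := dist_triangle4 (P v) (P M) (Q M) (Q w)
      rw [hPP v M h1 (by linarith) (by linarith) hM, hQQ M w (by linarith) hM h3 (by linarith),
        abs_of_nonpos (by linarith), abs_of_nonneg (by linarith)] at e1
      linarith
    -- A shorter connection between `P v` and `Q w` would shorten the whole route from `p` to `q`.
    · have e1 := dist_triangle4 (P p.depth) (P v) (Q w) (Q q.depth)
      rw [hPP _ v hp0 (by linarith) h1 (by linarith), hQQ w _ h3 (by linarith) hq0 (by linarith),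
        abs_of_nonpos (by linarith), abs_of_nonneg (by linarith)] at e1
      have e2 : dist (P p.depth) (Q q.depth) = d := by simp [hP, hQ, hddef]
      linarith
  have hPp : P p.depth = p := by simp [hP]
  have hQq : Q q.depth = q := by simp [hQ]
  have hmix : ∀ s ∈ Set.Icc 0 d, ∀ t ∈ Set.Icc 0 d, s ≤ M - p.depth → ¬ t ≤ M - p.depth →
      dist (P (p.depth + s)) (Q (q.depth + (d - t))) = |s - t| := by
    intro s hs t ht h1 h2
    rw [not_le] at h2
    have := hs.1
    have := ht.2
    rw [hPQ _ _ (by linarith) (by linarith) (by linarith) (by linarith) (by linarith)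
      (by linarith), abs_of_nonpos (by linarith)]
    linarith
  refine ⟨fun t => if t ≤ M - p.depth then P (p.depth + t) else Q (q.depth + (d - t)), ?_, ?_, ?_⟩
  · simp only [sub_nonneg, hp, if_true, add_zero, hPp, dist_self]
  · dsimp only
    split_ifs with hdM
    -- Here `q` itself is at the branch depth, so the route ends at `P M`, at distance zero from `Q
    -- M = q`.
    · have hMq : M = q.depth := by linarith
      have e1 : p.depth + d = M := by linarith
      rw [e1]
      refine le_antisymm ?_ dist_nonneg
      rwa [← hQq, ← hMq]
    · simp only [sub_self, add_zero, hQq, dist_self]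
  · intro s hs t ht
    have := hs.1
    have := ht.1
    have := hs.2
    have := ht.2
    dsimp only
    split_ifs with h1 h2 h2
    · rw [hPP _ _ (by linarith) (by linarith) (by linarith) (by linarith)]
      congr 1
      ring
    · exact hmix s hs t ht h1 h2
    · rw [dist_comm, hmix t ht s hs h2 h1, abs_sub_comm]
    · rw [hQQ _ _ (by linarith) (by linarith) (by linarith) (by linarith), abs_sub_comm]
      congr 1
      ring

theorem isRTree (h : ∀ σ τ : E, dist σ τ ≤ 1) : IsRTree (SeparationQuotient (EndTree E)) := by
  refine isRTree_of_fourPoint ?_ ?_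
  · intro x y z w
    obtain ⟨x, rfl⟩ := SeparationQuotient.surjective_mk x
    obtain ⟨y, rfl⟩ := SeparationQuotient.surjective_mk y
    obtain ⟨z, rfl⟩ := SeparationQuotient.surjective_mk z
    obtain ⟨w, rfl⟩ := SeparationQuotient.surjective_mk w
    simpa only [SeparationQuotient.dist_mk] using four_point x y z w
  · intro x y
    obtain ⟨x, rfl⟩ := SeparationQuotient.surjective_mk x
    obtain ⟨y, rfl⟩ := SeparationQuotient.surjective_mk y
    obtain ⟨γ, h0, h1, hγ⟩ := exists_geodesic h x y
    refine ⟨fun t => SeparationQuotient.mk (γ t), ?_, ?_, ?_⟩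
    · rw [← dist_eq_zero, SeparationQuotient.dist_mk, h0]
    · rw [← dist_eq_zero, SeparationQuotient.dist_mk, SeparationQuotient.dist_mk, h1]
    · simpa only [SeparationQuotient.dist_mk] using hγ

theorem dist_mk_le (σ τ : E) (a b : unitInterval) :
    dist (mk σ a) (mk τ b) ≤ |(a : ℝ) - b| + 2 * dist σ τ := by
  rw [dist_eq]
  have h := dist_nonneg (x := σ) (y := τ)
  have ha := a.2.1
  have hb := b.2.1
  have h1 := le_abs_self ((a : ℝ) - b)
  have h2 := neg_abs_le ((a : ℝ) - b)
  have h3 : branch (mk σ a) (mk τ b) ≤ max (a : ℝ) b + dist σ τ :=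
    max_le (by linarith) (by linarith [le_max_left (a : ℝ) b])
  rcases max_choice (a : ℝ) b with h4 | h4 <;> rw [h4] at h3 <;> simp only <;> linarith

instance compactSpace [CompactSpace E] : CompactSpace (SeparationQuotient (EndTree E)) := by
  have hc : Continuous fun z : E × unitInterval => mk z.1 z.2 := by
    rw [continuous_iff_continuousAt]
    rintro ⟨σ, a⟩
    rw [ContinuousAt, tendsto_iff_dist_tendsto_zero]
    refine squeeze_zero (fun _ => dist_nonneg) (fun z => dist_mk_le z.1 σ z.2 a) ?_
    have : Continuous fun z : E × unitInterval => |(z.2 : ℝ) - a| + 2 * dist z.1 σ := by fun_prop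
    simpa using this.tendsto (σ, a)
  have hs : Function.Surjective fun z : E × unitInterval => mk z.1 z.2 :=
    fun p => ⟨(p.tip, p.depth), rfl⟩
  have := hs.compactSpace hc
  exact SeparationQuotient.surjective_mk.compactSpace SeparationQuotient.continuous_mk

/-- Explicit McShane type extension: the value at `a` is the point of depth
`inf_b (depth (f b) + dist a b)` below the almost minimizing values `f b`. -/
theorem isInjectiveSpace [CompactSpace E] [Nonempty E] (h : ∀ σ τ : E, dist σ τ ≤ 1) :
    IsInjectiveSpace (SeparationQuotient (EndTree E)) := by
  intro A _ B f hf
  rw [lipConst_le_one_iff] at hf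
  rcases isEmpty_or_nonempty B with hB | hB
  · refine ⟨fun _ => SeparationQuotient.mk ⟨Classical.arbitrary E, 0⟩, ?_, fun b => hB.elim b⟩
    rw [lipConst_le_one_iff]
    exact (LipschitzWith.const _).weaken zero_le_one
  choose r hr using fun b => SeparationQuotient.surjective_mk (f b)
  have hrd : ∀ b b' : B, dist (r b) (r b') ≤ dist (b : A) b' := by
    intro b b'
    rw [← SeparationQuotient.dist_mk, hr, hr]
    simpa [Subtype.dist_eq] using hf.dist_le_mul b b'
  -- `pt a b` descends from `r b` by `dist a b`, stopping at the root, of depth 1.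
  have hv0 : ∀ (a : A) (b : B), 0 ≤ min 1 ((r b).depth + dist a b) := fun a b =>
    le_min zero_le_one (add_nonneg (r b).depth.2.1 dist_nonneg)
  set v : A → B → ℝ := fun a b => min 1 ((r b).depth + dist a b) with hv
  set pt : A → B → EndTree E := fun a b => ⟨(r b).tip, v a b, hv0 a b, min_le_left _ _⟩ with hpt
  have hbdd : ∀ a, BddBelow (Set.range (v a)) := fun a =>
    ⟨0, by rintro _ ⟨b, rfl⟩; exact hv0 a b⟩
  set H : A → ℝ := fun a => ⨅ b, v a b with hH
  have hHle : ∀ a b, H a ≤ v a b := fun a b => ciInf_le (hbdd a) b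
  have hHlip : ∀ a a', H a ≤ H a' + dist a a' := by
    intro a a'
    rw [← sub_le_iff_le_add]
    refine le_ciInf fun b => ?_
    have h1 := hHle a b
    have h2 := dist_triangle a a' b
    have h3 := dist_nonneg (x := a) (y := a')
    simp only [hv] at h1 ⊢
    rcases le_min_iff.1 h1 with ⟨h4, h5⟩
    exact le_min (by linarith) (by linarith)
  -- If the tips branch no deeper than one of the points, the distance is the difference of depths.
  -- Otherwise, if neither descent is truncated, both descents are saved from `dist (r b) (r b')`,
  -- leaving at most `dist a a'`. Truncation forces the branch point to be the root.
  have hpd : ∀ a a' b b', dist (pt a b) (pt a' b') ≤ max (dist a a') |v a b - v a' b'| := by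
    intro a a' b b'
    have hrb := hrd b b'
    have hb : dist (r b).tip (r b').tip ≤ branch (r b) (r b') := le_max_right _ _
    have h1 := h (r b).tip (r b').tip
    have h2 := le_abs_self (v a b - v a' b')
    have h3 := neg_abs_le (v a b - v a' b')
    have h4 := dist_triangle4 (b : A) a a' b'
    rw [dist_comm (b : A) a] at h4
    rw [dist_eq] at hrb ⊢
    rw [le_max_iff]
    have hbr : branch (pt a b) (pt a' b') =
      max (max (v a b) (v a' b')) (dist (r b).tip (r b').tip) := rfl
    have hd1 : ((pt a b).depth : ℝ) = v a b := rfl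
    have hd2 : ((pt a' b').depth : ℝ) = v a' b' := rfl
    rw [hbr, hd1, hd2]
    rcases le_total (dist (r b).tip (r b').tip) (max (v a b) (v a' b')) with h5 | h5
    · right
      rw [max_eq_left h5]
      rcases max_choice (v a b) (v a' b') with h6 | h6 <;> rw [h6] <;> linarith
    · rw [max_eq_right h5]
      rw [max_le_iff] at h5
      have h6 : v a b = 1 ∨ v a b = (r b).depth + dist a b := min_choice _ _
      have h7 : v a' b' = 1 ∨ v a' b' = (r b').depth + dist a' b' := min_choice _ _
      have h8 := dist_nonneg (x := a) (y := a')
      rcases h6 with h6 | h6 <;> rcases h7 with h7 | h7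
      · left; linarith
      · right; linarith
      · right; linarith
      · left; linarith
  -- For fixed `a`, the points `pt a b` are as far apart as their depths at most. A cluster point
  -- along a minimizing sequence of depths is the value sought.
  have hg : ∀ a, ∃ x : SeparationQuotient (EndTree E), ∀ b,
      dist x (SeparationQuotient.mk (pt a b)) ≤ v a b - H a := by
    intro a
    obtain ⟨u, -, hu, huS⟩ := exists_seq_tendsto_sInf (Set.range_nonempty (v a)) (hbdd a)
    choose β hβ using huS
    obtain ⟨x, -, φ, hφ, hx⟩ := isCompact_univ.tendsto_subseq
      (x := fun n => SeparationQuotient.mk (pt a (β n))) fun _ => Set.mem_univ _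
    refine ⟨x, fun b => ?_⟩
    have h1 : Filter.Tendsto (fun n => |u (φ n) - v a b|) Filter.atTop (nhds |H a - v a b|) :=
      ((hu.comp hφ.tendsto_atTop).sub_const _).abs
    rw [abs_of_nonpos (by linarith [hHle a b]), neg_sub] at h1
    refine le_of_tendsto_of_tendsto' (hx.dist tendsto_const_nhds) h1 fun n => ?_
    have h2 := hpd a a (β (φ n)) b
    rw [dist_self, max_eq_right (abs_nonneg _), hβ] at h2
    exact h2
  choose g hg using hg
  refine ⟨g, ?_, fun b => ?_⟩
  · rw [lipConst_le_one_iff]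
    refine LipschitzWith.of_dist_le_mul fun a a' => ?_
    rw [NNReal.coe_one, one_mul]
    refine le_of_forall_pos_le_add fun ε hε => ?_
    obtain ⟨b, hb⟩ := exists_lt_of_ciInf_lt (show ⨅ b, v a b < H a + ε / 4 by linarith)
    obtain ⟨b', hb'⟩ := exists_lt_of_ciInf_lt (show ⨅ b, v a' b < H a' + ε / 4 by linarith)
    have h1 := dist_triangle4 (g a) (SeparationQuotient.mk (pt a b))
      (SeparationQuotient.mk (pt a' b')) (g a')
    have h2 := hg a b
    have h3 := hg a' b'
    rw [dist_comm] at h3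
    rw [SeparationQuotient.dist_mk] at h1
    have h4 := hpd a a' b b'
    have h5 : |v a b - v a' b'| ≤ dist a a' + ε / 4 := by
      have h6 := hHlip a a'
      have h7 := hHlip a' a
      rw [dist_comm] at h7
      rw [abs_le]
      constructor <;> linarith [hHle a b, hHle a' b']
    rcases le_max_iff.1 h4 with h6 | h6 <;> linarith
  · have h0 : v b b = (r b).depth := by simp [hv, (r b).depth.2.2]
    have h1 : pt b b = r b := EndTree.ext rfl (Subtype.ext h0)
    -- Depth is 1-Lipschitz on the tree, so at `b` the infimum is attained by `b` itself.
    have h2 : v b b ≤ H b := by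
      refine le_ciInf fun b' => ?_
      rw [h0]
      refine le_min (r b).depth.2.2 ?_
      have h3 := hrd b b'
      rw [dist_eq] at h3
      linarith [le_branch_left (r b) (r b')]
    have h3 := hg b b
    rw [h1, hr] at h3
    exact dist_le_zero.1 (h3.trans (by linarith))

/-- A family of Lipschitz rays, agreeing as long as the ends agree, induces a Lipschitz map on the
tree. -/
theorem lipschitzWith_of_rays {X : Type v} [PseudoMetricSpace X] {K : ℝ≥0}
    (h : ∀ σ τ : E, dist σ τ ≤ 1) (F : E → ℝ → X) (hF : ∀ σ, ∀ a ∈ Set.Icc (0 : ℝ) 1,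
      ∀ b ∈ Set.Icc (0 : ℝ) 1, dist (F σ a) (F σ b) ≤ K * |a - b|)
    (hFF : ∀ σ τ, ∀ a ∈ Set.Icc (0 : ℝ) 1, dist σ τ ≤ a → F σ a = F τ a) :
    LipschitzWith K fun p : EndTree E => F p.tip p.depth := by
  refine LipschitzWith.of_dist_le_mul fun p q => ?_
  have hp := le_branch_left p q
  have hq := le_branch_right p q
  have hM : branch p q ∈ Set.Icc (0 : ℝ) 1 := ⟨p.depth.2.1.trans hp, branch_le_one h p q⟩
  have h1 := hF p.tip _ p.depth.2 _ hM
  have h2 := hF q.tip _ hM _ q.depth.2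
  -- The two rays meet at the branch depth, so the estimate passes through that point.
  rw [← hFF p.tip q.tip _ hM (le_max_right _ _), abs_of_nonneg (by linarith)] at h2
  rw [abs_of_nonpos (by linarith)] at h1
  have h3 := dist_triangle (F p.tip p.depth) (F p.tip (branch p q)) (F q.tip q.depth)
  rw [dist_eq]
  linarith

end EndTree

/-! ### Lipschitz rays through prescribed points -/

theorem lipschitzWith_ite_le {X : Type u} [PseudoMetricSpace X] {K : ℝ≥0} {F G : ℝ → X}
    (hF : LipschitzWith K F) (hG : LipschitzWith K G) {c : ℝ} (hc : F c = G c) :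
    LipschitzWith K fun s => if c ≤ s then F s else G s := by
  have key : ∀ s t : ℝ, c ≤ s → ¬ c ≤ t → dist (F s) (G t) ≤ K * dist s t := by
    intro s t hs ht
    have h1 := hF.dist_le_mul s c
    have h2 := hG.dist_le_mul c t
    have h3 := dist_triangle (F s) (F c) (G t)
    rw [Real.dist_eq, abs_of_nonneg (by linarith)] at h1 h2 ⊢
    rw [hc] at h1 h3
    linarith
  refine LipschitzWith.of_dist_le_mul fun s t => ?_
  split_ifs with hs ht ht
  · exact hF.dist_le_mul s t
  · exact key s t hs ht
  · rw [dist_comm, dist_comm s]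
    exact key t s ht hs
  · exact hG.dist_le_mul s t

variable {X : Type u} [MetricSpace X]

/-- A Lipschitz ray that rests on `(-∞, 2c]` can be continued on `[c, 2c]` along a path. -/
theorem exists_ray_extension {K c : ℝ≥0} (hc : 0 < c) {P : ℝ → X} {z : X}
    (hP : LipschitzWith K P) (hPc : ∀ a ≤ (2 * c : ℝ), P a = P 0)
    (hz : intrinsicEDist (P 0) z < (K * c : ℝ≥0)) :
    ∃ P' : ℝ → X, LipschitzWith K P' ∧ (∀ a ≤ (c : ℝ), P' a = P' 0) ∧
      (∀ a ≥ (2 * c : ℝ), P' a = P a) ∧ P' 0 = z := by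
  obtain ⟨q, q0, q1, hq⟩ := exists_path_of_intrinsicEDist_lt hz
  have hc' : (0 : ℝ) < c := hc
  -- The path has constant `K * c` and is run backwards over an interval of length `c`, hence at
  -- speed `K`. The projection freezes it at `z` for `a ≤ c`.
  set G : ℝ → X := fun a => q (Set.projIcc 0 1 zero_le_one ((2 * c - a) / c)) with hG
  have hGL : LipschitzWith K G := by
    refine LipschitzWith.of_dist_le_mul fun s t => (hq.dist_le_mul _ _).trans ?_
    have h1 := (LipschitzWith.projIcc (zero_le_one (α := ℝ))).dist_le_mul
      ((2 * c - s) / c) ((2 * c - t) / c)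
    rw [NNReal.coe_one, one_mul] at h1
    calc ((K * c : ℝ≥0) : ℝ) * _ ≤ (K * c : ℝ≥0) * dist ((2 * c - s) / (c : ℝ)) ((2 * c - t) / c) :=
          mul_le_mul_of_nonneg_left h1 (NNReal.coe_nonneg _)
      _ = K * dist s t := by
        rw [Real.dist_eq, Real.dist_eq, ← sub_div, sub_sub_sub_cancel_left, abs_div,
          abs_of_pos hc', abs_sub_comm]
        push_cast
        field_simp
  have hGz : ∀ a ≤ (c : ℝ), G a = z := by
    intro a ha
    have : Set.projIcc (0 : ℝ) 1 zero_le_one ((2 * c - a) / c) = 1 :=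
      Set.projIcc_of_right_le _ ((one_le_div hc').2 (by linarith))
    simp only [hG, this, q1]
  have hite : ∀ a ≤ (c : ℝ), (if 2 * (c : ℝ) ≤ a then P a else G a) = z := by
    intro a ha
    rw [if_neg (by linarith), hGz a ha]
  refine ⟨fun a => if 2 * (c : ℝ) ≤ a then P a else G a, ?_, ?_, ?_, hite 0 hc'.le⟩
  · refine lipschitzWith_ite_le hP hGL ?_
    have : Set.projIcc (0 : ℝ) 1 zero_le_one ((2 * c - 2 * c) / c) = 0 := by simp
    simp only [hG, this, q0, hPc _ le_rfl]
  · intro a ha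
    exact (hite a ha).trans (hite 0 hc'.le).symm
  · intro a ha
    exact if_pos ha

/-- Rays running through prescribed sequences of points, as long as consecutive points are close
in the intrinsic metric, depending on the sequences in a nonanticipative way. -/
theorem exists_rays [CompleteSpace X] (K : ℝ≥0) (x₀ : X) :
    ∃ F : (ℕ → X) → ℝ → X, (∀ σ, ∀ a ∈ Set.Icc (0 : ℝ) 1, ∀ b ∈ Set.Icc (0 : ℝ) 1,
        dist (F σ a) (F σ b) ≤ K * |a - b|) ∧
      (∀ σ τ n, (∀ i < n, σ i = τ i) → ∀ a ≥ (1 / 2 : ℝ) ^ n, F σ a = F τ a) ∧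
      ∀ σ y, intrinsicEDist x₀ (σ 0) < (K * (1 / 2) : ℝ≥0) →
        (∀ n, intrinsicEDist (σ n) (σ (n + 1)) < (K * (1 / 2) ^ (n + 2) : ℝ≥0)) →
        Filter.Tendsto σ Filter.atTop (nhds y) → F σ 0 = y := by
  -- The state after `n` points of the sequence: a ray at rest below depth `2⁻ⁿ`, still free to be
  -- continued there.
  let S : ℕ → Type u := fun n =>
    {P : ℝ → X // LipschitzWith K P ∧ ∀ a ≤ (1 / 2 : ℝ) ^ n, P a = P 0}
  have hstep : ∀ n (P : S n) (z : X), ∃ P' : S (n + 1),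
      (∀ a ≥ (1 / 2 : ℝ) ^ n, P'.1 a = P.1 a) ∧
      (intrinsicEDist (P.1 0) z < (K * (1 / 2) ^ (n + 1) : ℝ≥0) → P'.1 0 = z) := by
    rintro n ⟨P, hP, hPn⟩ z
    by_cases hz : intrinsicEDist (P 0) z < (K * (1 / 2) ^ (n + 1) : ℝ≥0)
    · have h2 : (2 * ((1 / 2 : ℝ≥0) ^ (n + 1) : ℝ≥0) : ℝ) = (1 / 2) ^ n := by
        push_cast
        ring
      obtain ⟨P', h3, h4, h5, h6⟩ := exists_ray_extension (by positivity) hP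
        (by rwa [h2]) hz
      rw [h2] at h5
      refine ⟨⟨P', h3, fun a ha => h4 a ?_⟩, h5, fun _ => h6⟩
      push_cast
      exact ha
    -- A point that is too far away is skipped, so that every sequence yields a ray.
    · refine ⟨⟨P, hP, fun a ha => hPn a (ha.trans ?_)⟩, fun _ _ => rfl, fun h => absurd h hz⟩
      exact pow_le_pow_of_le_one (by norm_num) (by norm_num) n.le_succ
  choose step hs1 hs2 using hstep
  let R : (ℕ → X) → ∀ n, S n := fun σ n =>
    Nat.rec ⟨fun _ => x₀, LipschitzWith.const' x₀, fun _ _ => rfl⟩ (fun n P => step n P (σ n)) n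
  have hR : ∀ σ n, R σ (n + 1) = step n (R σ n) (σ n) := fun _ _ => rfl
  have hR0 : ∀ σ a, (R σ 0).1 a = x₀ := fun _ _ => rfl
  have hRR : ∀ σ τ n, (∀ i < n, σ i = τ i) → R σ n = R τ n := by
    intro σ τ n
    induction n with
    | zero => exact fun _ => rfl
    | succ n ih =>
      intro h
      rw [hR, hR, ih fun i hi => h i (hi.trans n.lt_succ_self), h n n.lt_succ_self]
  have hRm : ∀ σ n m, n ≤ m → ∀ a ≥ (1 / 2 : ℝ) ^ n, (R σ m).1 a = (R σ n).1 a := by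
    intro σ n m hnm a ha
    induction m, hnm using Nat.le_induction with
    | base => rfl
    | succ m hm ih =>
      rw [hR, hs1 _ _ _ _ (le_trans (pow_le_pow_of_le_one (by norm_num) (by norm_num) hm) ha), ih]
  have hcauchy : ∀ σ, ∀ a ≥ (0 : ℝ), CauchySeq fun n => (R σ n).1 a := by
    intro σ a ha
    refine cauchySeq_of_le_geometric (1 / 2) (K : ℝ) (by norm_num) fun n => ?_
    rcases le_total ((1 / 2 : ℝ) ^ n) a with h | h
    · rw [hRm σ n (n + 1) n.le_succ a h, dist_self]
      positivity
    -- At depths up to `2⁻ⁿ` the old ray rests at its value at `2⁻ⁿ`, from which the new one moves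
    -- by at most `K * 2⁻ⁿ`.
    · have h1 := (R σ (n + 1)).2.1.dist_le_mul ((1 / 2 : ℝ) ^ n) a
      rw [hRm σ n (n + 1) n.le_succ _ le_rfl, (R σ n).2.2 _ le_rfl, ← (R σ n).2.2 _ h,
        Real.dist_eq, abs_of_nonneg (by linarith)] at h1
      refine h1.trans (mul_le_mul_of_nonneg_left (by linarith) K.2)
  have : Nonempty X := ⟨x₀⟩
  choose! F hF using fun σ a ha => cauchySeq_tendsto_of_complete (hcauchy σ a ha)
  have hFR : ∀ σ n, ∀ a ≥ (1 / 2 : ℝ) ^ n, F σ a = (R σ n).1 a := by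
    intro σ n a ha
    have h0 : a ≥ 0 := le_trans (by positivity) ha
    exact tendsto_nhds_unique (hF σ a h0) (tendsto_atTop_of_eventually_const (i₀ := n)
      fun m hm => hRm σ n m hm a ha)
  refine ⟨F, ?_, ?_, ?_⟩
  · intro σ a ha b hb
    exact le_of_tendsto' ((hF σ a ha.1).dist (hF σ b hb.1)) fun n =>
      (R σ n).2.1.dist_le_mul a b
  · intro σ τ n h a ha
    rw [hFR σ n a ha, hFR τ n a ha, hRR σ τ n h]
  · intro σ y h0 hn hy
    -- Stage 0 is the constant ray at `x₀`, so `σ n` is reached only at stage `n + 1`.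
    have hpos : ∀ n, (R σ (n + 1)).1 0 = σ n := by
      intro n
      induction n with
      | zero =>
        refine hs2 0 (R σ 0) (σ 0) ?_
        rwa [hR0, zero_add, pow_one]
      | succ n ih =>
        refine hs2 (n + 1) (R σ (n + 1)) (σ (n + 1)) ?_
        rw [ih]
        exact hn n
    refine tendsto_nhds_unique ((Filter.tendsto_add_atTop_iff_nat 1).2 (hF σ 0 le_rfl)) ?_
    simpa only [hpos] using hy

/-! ### The tree over sequences of net points -/

theorem dist_le_intrinsicEDist_toReal (h : IsLipschitzConnected X) (x y : X) :
    dist x y ≤ (intrinsicEDist x y).toReal := by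
  rw [dist_edist]
  exact ENNReal.toReal_mono (intrinsicEDist_ne_top h x y) (edist_le_intrinsicEDist x y)

/-- A compact Lipschitz connected space with totally bounded intrinsic metric is a Lipschitz image
of a compact injective `ℝ`-tree. -/
theorem exists_compact_tree [Nonempty X] [CompactSpace X] (h : IsLipschitzConnected X)
    (htb : @IsTotallyBounded X (intrinsicMetricSpace h)) :
    ∃ (Y : Type u) (_ : MetricSpace Y), CompactSpace Y ∧ IsRTree Y ∧ IsInjectiveSpace Y ∧
      IsLipschitzImage X Y := by
  rw [isTotallyBounded_intrinsicMetricSpace_iff] at htb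
  have htri : ∀ x y z : X, (intrinsicEDist x z).toReal ≤
      (intrinsicEDist x y).toReal + (intrinsicEDist y z).toReal :=
    (intrinsicMetricSpace h).dist_triangle
  have hcomm : ∀ x y : X, (intrinsicEDist x y).toReal = (intrinsicEDist y x).toReal :=
    (intrinsicMetricSpace h).dist_comm
  have hlt : ∀ (x y : X) (c : ℝ≥0), (intrinsicEDist x y).toReal < c → intrinsicEDist x y < c := by
    intro x y c hc
    rw [← ENNReal.ofReal_coe_nnreal]
    exact (ENNReal.lt_ofReal_iff_toReal_lt (intrinsicEDist_ne_top h x y)).2 hc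
  let x₀ : X := Classical.arbitrary X
  obtain ⟨C, hC0, hC⟩ : ∃ C : ℝ≥0, 0 < C ∧ ∀ y, (intrinsicEDist x₀ y).toReal < C := by
    obtain ⟨t, ht, hcov⟩ := htb 1 one_pos
    obtain ⟨M, hM⟩ := (ht.image fun y => (intrinsicEDist x₀ y).toReal).bddAbove
    have hlow : ∀ y, (intrinsicEDist x₀ y).toReal < M + 1 := by
      intro y
      obtain ⟨z, hz, hyz⟩ := hcov y
      have h1 := hM (Set.mem_image_of_mem _ hz)
      have h2 := htri x₀ z y
      rw [hcomm z y] at h2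
      linarith
    have hpos : 0 < M + 1 := ENNReal.toReal_nonneg.trans_lt (hlow x₀)
    exact ⟨⟨M + 1, hpos.le⟩, hpos, hlow⟩
  have hC0' : (0 : ℝ) < C := hC0
  choose A hAfin hA using fun n : ℕ => htb (C * (1 / 2) ^ n) (by positivity)
  -- Approximations of one point in consecutive nets are less than `(3/2) * C * 2⁻ⁿ` apart, within
  -- the allowance `8 * C * 2⁻⁽ⁿ⁺²⁾ = 2 * C * 2⁻ⁿ`. The first step needs `C < 4 * C`.
  obtain ⟨F, hF1, hF2, hF3⟩ := exists_rays (8 * C) x₀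
  have hAne : ∀ n, Nonempty (A n) := fun n =>
    let ⟨y, hy, _⟩ := hA n x₀
    ⟨⟨y, hy⟩⟩
  have : ∀ n, Finite (A n) := fun n => (hAfin n).to_subtype
  let _ : ∀ n, TopologicalSpace (A n) := fun _ => ⊥
  have : ∀ n, DiscreteTopology (A n) := fun _ => ⟨rfl⟩
  have hcomp : CompactSpace (∀ n, A n) := inferInstance
  let _ : MetricSpace (∀ n, A n) := PiNat.metricSpace
  have : IsUltrametricDist (∀ n, A n) := ⟨PiNat.dist_triangle_nonarch⟩
  have : CompactSpace (∀ n, A n) := hcomp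
  have hdist : ∀ σ τ : ∀ n, A n, dist σ τ ≤ 1 := PiNat.dist_le_one
  have hlip := EndTree.lipschitzWith_of_rays (K := 8 * C) hdist
    (fun σ => F fun n => σ n) (fun σ => hF1 _) (by
      intro σ τ a _ ha
      by_cases hστ : σ = τ
      · rw [hστ]
      -- The distance is `(1/2)` to the power of the first index of disagreement, exactly the depth
      -- down to which the rays coincide.
      · rw [PiNat.dist_eq_of_ne hστ] at ha
        refine hF2 _ _ _ (fun i hi => ?_) a ha
        rw [PiNat.apply_eq_of_lt_firstDiff hi])
  refine ⟨SeparationQuotient (EndTree (∀ n, A n)), inferInstance, inferInstance,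
    EndTree.isRTree hdist, EndTree.isInjectiveSpace hdist,
    SeparationQuotient.lift _ fun p q hpq => (hpq.map hlip.continuous).eq, ?_, ?_⟩
  · intro y
    choose σ hσA hσ using fun n => hA n y
    -- The preimage is the end itself, at depth 0, where the ray reaches the limit of `σ`.
    refine ⟨SeparationQuotient.mk ⟨fun n => ⟨σ n, hσA n⟩, 0⟩, ?_⟩
    rw [SeparationQuotient.lift_mk]
    refine hF3 σ y (hlt _ _ _ ?_) (fun n => hlt _ _ _ ?_) ?_
    · have := hC (σ 0)
      push_cast
      linarith
    · have h1 := htri (σ n) y (σ (n + 1))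
      rw [hcomm (σ n) y] at h1
      have h2 := hσ n
      have h3 := hσ (n + 1)
      have h4 : 0 < (C : ℝ) * (1 / 2) ^ n := by positivity
      push_cast
      rw [pow_succ] at h3
      rw [pow_add]
      linarith
    · rw [tendsto_iff_dist_tendsto_zero]
      refine squeeze_zero (g := fun n : ℕ => (C : ℝ) * (1 / 2) ^ n) (fun _ => dist_nonneg)
        (fun n => ?_) ?_
      · rw [dist_comm]
        exact (dist_le_intrinsicEDist_toReal h _ _).trans (hσ n).le
      · simpa using (tendsto_pow_atTop_nhds_zero_of_lt_one (r := (1 / 2 : ℝ)) (by norm_num)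
          (by norm_num)).const_mul (C : ℝ)
  · refine (isLipschitz_iff _).2 ⟨8 * C, LipschitzWith.of_dist_le_mul fun x y => ?_⟩
    obtain ⟨p, rfl⟩ := SeparationQuotient.surjective_mk x
    obtain ⟨q, rfl⟩ := SeparationQuotient.surjective_mk y
    rw [SeparationQuotient.dist_mk]
    exact hlip.dist_le_mul p q

end LipschitzImages

theorem theorem1p3 (X : Type u) [MetricSpace X] [Nonempty X] :
    List.TFAE [
      ∃ (Y : Type u) (_ : MetricSpace Y), LipschitzImages.IsTotallyBounded Y ∧
        LipschitzImages.IsInjectiveSpace Y ∧ LipschitzImages.IsLipschitzImage X Y,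
      ∃ (Y : Type u) (_ : MetricSpace Y), CompactSpace Y ∧
        LipschitzImages.IsRTree Y ∧ LipschitzImages.IsLipschitzImage X Y,
      CompactSpace X ∧ ∃ h : LipschitzImages.IsLipschitzConnected X,
        @LipschitzImages.IsTotallyBounded X (LipschitzImages.intrinsicMetricSpace h)] := by
  tfae_have 1 → 3 := by
    rintro ⟨Y, _, htb, hinj, hXY⟩
    have := hinj.completeSpace
    have : CompactSpace Y := ⟨htb.isCompact_of_isComplete isClosed_univ.isComplete⟩
    exact LipschitzImages.compactSpace_and_intrinsic_totallyBounded hinj.isGeodesic hXY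
  tfae_have 2 → 3 := by
    rintro ⟨Y, _, _, htree, hXY⟩
    exact LipschitzImages.compactSpace_and_intrinsic_totallyBounded htree.isGeodesic hXY
  tfae_have 3 → 1 := by
    rintro ⟨_, h, htb⟩
    obtain ⟨Y, hY, hc, -, hinj, hXY⟩ := LipschitzImages.exists_compact_tree h htb
    exact ⟨Y, hY, isCompact_univ.totallyBounded, hinj, hXY⟩
  tfae_have 3 → 2 := by
    rintro ⟨_, h, htb⟩
    obtain ⟨Y, hY, hc, htree, -, hXY⟩ := LipschitzImages.exists_compact_tree h htb
    exact ⟨Y, hY, hc, htree, hXY⟩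
  tfae_finish
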